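/- Let $N\ge 1$, let $G$ be a finite simple graph on $\{1,\dots,N\}$ (the neighbourhood graph of $N$ regions), and let $Q$ be the $N\times N$ matrix with $Q_{ii}$ the number of neighbours of $i$, $Q_{ij}=-1$ if $i\neq j$ are adjacent, and $Q_{ij}=0$ otherwise. Let $Y_i>0$ be the observed counts (any positive real values are allowed, so that zero counts may be replaced by $1/2$ in the data) and $E_i>0$ the expected counts, $i=1,\dots,N$, and let $\alpha_h,\alpha_c,\beta_h,\beta_c>0$. On the state space $\Omega=\{(\tau_h,\tau_c,\Theta):\tau_h>0,\ \tau_c>0,\ \Theta=(\theta,\phi)\in\mathbb{R}^N\times\mathbb{R}^N\}$ with Lebesgue measure, let $\pi$ be the posterior distribution of the Poisson–Markov random field model, with density $$\pi(\tau_h,\tau_c,\Theta)\propto \exp\Big(\sum_{i=1}^N\big((\theta_i+\phi_i)Y_i-E_ie^{\theta_i+\phi_i}\big)\Big)\,e^{-\frac{\tau_h}{2}\theta^T\theta}\,e^{-\frac{\tau_c}{2}\phi^TQ\phi}\;\tau_h^{N/2+\alpha_h-1}\,\tau_c^{(N-1)/2+\alpha_c-1}\,e^{-\tau_h/\beta_h-\tau_c/\beta_c}.$$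 Let $\nu_h,\nu_c,\nu_r$ be positive integers, $\mu_h,\mu_c\in\mathbb{R}$, $\sigma_h,\sigma_c>0$, $\delta\ge 0$. Put $V^{-1}=\mathrm{diag}(Y_1,\dots,Y_N)$, $\hat\mu_i=\log(Y_i/E_i)$, $D=(-2\hat\mu^TV^{-1},-2\hat\mu^TV^{-1})$, $$C_\delta(\tau_h,\tau_c)=\begin{bmatrix}V^{-1}+\tau_hI & V^{-1}\\ V^{-1} & V^{-1}+\tau_c(Q+\delta I)\end{bmatrix},\qquad C=C_0(\tau_h,\tau_c),\qquad \mu_N=-\tfrac12\,C_\delta(\tau_h,\tau_c)^{-1}D^T .$$ Let $r$ be the probability distribution on $\Omega$ with density proportional to $r_1(\tau_h,\tau_c)\,r_2(\Theta\mid\tau_h,\tau_c)$, where $r_1$ is the product of log-$t$ densities $$r_1(\tau_h,\tau_c)\propto\frac{1}{\tau_h\tau_c}\Big[1+\tfrac{1}{\nu_h}\big(\tfrac{\log\tau_h-\mu_h}{\sigma_h}\big)^2\Big]^{-(\nu_h+1)/2}\Big[1+\tfrac{1}{\nu_c}\big(\tfrac{\log\tau_c-\mu_c}{\sigma_c}\big)^2\Big]^{-(\nu_c+1)/2}$$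 and $r_2$ is the multivariate-$t$ density $$r_2(\Theta\mid\tau_h,\tau_c)=\frac{|C|^{1/2}\,\Gamma\big(\frac{\nu_r+2N}{2}\big)}{(\nu_r\pi)^{N}\,\Gamma(\nu_r/2)}\Big(1+\tfrac1{\nu_r}(\Theta-\mu_N)^TC(\Theta-\mu_N)\Big)^{-(\nu_r+2N)/2}$$ (in the last constant, $\pi$ is the number). Consider the independence Metropolis–Hastings chain on $\Omega$ with target $\pi$ and proposal $r$: from $x$ it draws $y\sim r$, moves to $y$ with probability $\min\{1,\frac{\pi(y)\,r(x)}{\pi(x)\,r(y)}\}$ and otherwise stays at $x$; let $P$ be its transition kernel. Then $\pi$ and $r$ are well-defined probability distributions, $P$ is a Markov kernel with invariant distribution $\pi$, and the chain is uniformly ergodic: there are constants $M$ and $t\in(0,1)$ with $$\sup_{A\subseteq\Omega\text{ measurable}}|P^n(x,A)-\pi(A)|\le M\,t^n\qquad\text{for all }x\in\Omega\text{ and all }n\ge 0 .$$ -/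

import Mathlib

open MeasureTheory ProbabilityTheory
open scoped ENNReal Matrix

noncomputable section

/-! ### General Markov chain notions -/

/-- The measure with (possibly unnormalised) density `f` with respect to `lam`, rescaled to have
total mass one (this makes sense as soon as `f` has a finite, positive integral). -/
def normalizedMeasure {Ω : Type*} [MeasurableSpace Ω] (lam : Measure Ω) (f : Ω → ℝ) : Measure Ω :=
  (∫⁻ x, ENNReal.ofReal (f x) ∂lam)⁻¹ • lam.withDensity (fun x => ENNReal.ofReal (f x))

instance normalizedMeasure.instSFinite {Ω : Type*} [MeasurableSpace Ω] (lam : Measure Ω)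
    [SFinite lam] (f : Ω → ℝ) : SFinite (normalizedMeasure lam f) := by
  unfold normalizedMeasure
  infer_instance

/-- Total variation distance `sup_A |μ(A) - ν(A)|`, the supremum being over measurable sets. -/
def tvDist {Ω : Type*} [MeasurableSpace Ω] (μ ν : Measure Ω) : ℝ :=
  ⨆ A : {A : Set Ω // MeasurableSet A}, |μ.real A.1 - ν.real A.1|

/-- The acceptance probability `min (1, (p(y)/q(y)) / (p(x)/q(x)))` of a proposed move from `x` to
`y`, for positive target density `p` and positive proposal density `q` (each known up to a constant
factor). -/
def acceptProb {Ω : Type*} (p q : Ω → ℝ) (x y : Ω) : ℝ :=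
  min 1 ((p y * q x) / (p x * q y))

/-- The transition kernel of the independence Metropolis-Hastings chain: from `x`, draw `y` from the
proposal (independently of `x`), move to `y` with probability `acceptProb p q x y` and stay at `x`
otherwise. -/
def independenceMH {Ω : Type*} [MeasurableSpace Ω] (lam : Measure Ω) [SFinite lam] (p q : Ω → ℝ)
    (hp : Measurable p) (hq : Measurable q) : Kernel Ω Ω where
  toFun x :=
    (normalizedMeasure lam q).withDensity (fun y => ENNReal.ofReal (acceptProb p q x y)) +
      (1 - ∫⁻ y, ENNReal.ofReal (acceptProb p q x y) ∂(normalizedMeasure lam q)) •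
        Measure.dirac x
  measurable' := by
    have h : Measurable fun z : Ω × Ω => ENNReal.ofReal (acceptProb p q z.1 z.2) := by
      unfold acceptProb
      fun_prop
    refine Measure.measurable_of_measurable_coe _ fun s hs => ?_
    simp only [Measure.coe_add, Pi.add_apply, Measure.smul_apply, smul_eq_mul,
      withDensity_apply _ hs, Measure.dirac_apply' _ hs]
    refine Measurable.add ?_ (Measurable.mul ?_ (measurable_one.indicator hs))
    · exact h.lintegral_prod_right'
    · exact measurable_const.sub h.lintegral_prod_right'

/-- Uniform ergodicity: the `n`-step transition laws converge to `target` in total variation at a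
geometric rate, uniformly in the starting point. -/
def UniformlyErgodic {Ω : Type*} [MeasurableSpace Ω] (P : Kernel Ω Ω) (target : Measure Ω) : Prop :=
  ∃ M t : ℝ, 0 < t ∧ t < 1 ∧ ∀ (x : Ω) (n : ℕ), tvDist ((P ^ n) x) target ≤ M * t ^ n

/-! ### The Poisson Markov random field model -/

/-- Data and hyperparameters of the model: the neighbourhood graph of the `N` regions, the observed
counts `Y`, the expected counts `E`, and the shapes `αh, αc` and scales `βh, βc` of the gamma priors.
The `Y i` may be any positive reals. -/
structure PoissonMRF (N : ℕ) where
  graph : SimpleGraph (Fin N)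
  Y : Fin N → ℝ
  Y_pos : ∀ i, 0 < Y i
  E : Fin N → ℝ
  E_pos : ∀ i, 0 < E i
  αh : ℝ
  αh_pos : 0 < αh
  αc : ℝ
  αc_pos : 0 < αc
  βh : ℝ
  βh_pos : 0 < βh
  βc : ℝ
  βc_pos : 0 < βc

/-- Tuning constants of the heavy-tailed proposal: degrees of freedom, locations and scales of the
two log-t distributions, degrees of freedom `νr` of the multivariate t distribution, and the
regularisation `δ` used in its centre (`δ = 0` means no regularisation). -/
structure ProposalParams where
  νh : ℕ
  νh_pos : 0 < νh
  νc : ℕ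
  νc_pos : 0 < νc
  νr : ℕ
  νr_pos : 0 < νr
  μh : ℝ
  μc : ℝ
  σh : ℝ
  σh_pos : 0 < σh
  σc : ℝ
  σc_pos : 0 < σc
  δ : ℝ
  δ_nonneg : 0 ≤ δ

/-- The vectors `Θ = (θ, φ)` of random effects. -/
abbrev Effects (N : ℕ) : Type := Fin N ⊕ Fin N → ℝ

/-- The state space: all `(τ_h, τ_c, Θ)` with `τ_h > 0`, `τ_c > 0`, `Θ ∈ ℝ^{2N}`. -/
abbrev State (N : ℕ) : Type := {z : ℝ × ℝ × Effects N // 0 < z.1 ∧ 0 < z.2.1}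

namespace State

variable {N : ℕ}

def τh (z : State N) : ℝ := z.1.1

def τc (z : State N) : ℝ := z.1.2.1

def Θ (z : State N) : Effects N := z.1.2.2

def θ (z : State N) : Fin N → ℝ := fun i => z.Θ (Sum.inl i)

def φ (z : State N) : Fin N → ℝ := fun i => z.Θ (Sum.inr i)

/-- Lebesgue measure on the state space. -/
def lebesgue (N : ℕ) : Measure (State N) := Measure.comap Subtype.val volume

lemma measurableSet_range (N : ℕ) :
    MeasurableSet {z : ℝ × ℝ × Effects N | 0 < z.1 ∧ 0 < z.2.1} :=
  (measurableSet_lt measurable_const measurable_fst).inter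
    (measurableSet_lt measurable_const measurable_snd.fst)

instance instSFinite (N : ℕ) : SFinite (lebesgue N) := by
  have ho : IsOpen {z : ℝ × ℝ × Effects N | 0 < z.1 ∧ 0 < z.2.1} :=
    (isOpen_lt continuous_const continuous_fst).inter
      (isOpen_lt continuous_const continuous_snd.fst)
  have : LocallyCompactSpace (State N) := ho.locallyCompactSpace
  have : IsFiniteMeasureOnCompacts (lebesgue N) :=
    IsFiniteMeasureOnCompacts.comap' _ continuous_subtype_val
      (MeasurableEmbedding.subtype_coe (measurableSet_range N))
  infer_instance

@[fun_prop]
lemma measurable_τh : Measurable (τh : State N → ℝ) := by unfold τh; fun_prop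

@[fun_prop]
lemma measurable_τc : Measurable (τc : State N → ℝ) := by unfold τc; fun_prop

@[fun_prop]
lemma measurable_Θ : Measurable (Θ : State N → Effects N) := by unfold Θ; fun_prop

@[fun_prop]
lemma measurable_θ : Measurable (θ : State N → Fin N → ℝ) := by unfold θ; fun_prop

@[fun_prop]
lemma measurable_φ : Measurable (φ : State N → Fin N → ℝ) := by unfold φ; fun_prop

end State

namespace PoissonMRF

variable {N : ℕ} (m : PoissonMRF N)

open Classical in
/-- The matrix `Q`: number of neighbours on the diagonal, `-1` for adjacent pairs, else `0`. -/
def Q : Matrix (Fin N) (Fin N) ℝ := m.graph.lapMatrix ℝ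

/-- `V⁻¹ = diag (Y₁, …, Y_N)`. -/
def Vinv : Matrix (Fin N) (Fin N) ℝ := Matrix.diagonal m.Y

/-- `μ̂ᵢ = log (Yᵢ / Eᵢ)`. -/
def μhat : Fin N → ℝ := fun i => Real.log (m.Y i / m.E i)

/-- The posterior density of `(τ_h, τ_c, Θ)`, up to its normalising constant:
Poisson likelihood, normal prior on `θ`, GMRF prior on `φ`, gamma priors on `τ_h`, `τ_c`. -/
def posteriorDensity (z : State N) : ℝ :=
  Real.exp (∑ i, ((z.θ i + z.φ i) * m.Y i - m.E i * Real.exp (z.θ i + z.φ i))) *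
    Real.exp (-(1 / 2) * (z.τh * (z.θ ⬝ᵥ z.θ))) *
    (z.τh ^ ((N : ℝ) / 2 + m.αh - 1) * z.τc ^ (((N : ℝ) - 1) / 2 + m.αc - 1)) *
    Real.exp (-(1 / 2) * (z.τc * (z.φ ⬝ᵥ (m.Q *ᵥ z.φ)))) *
    Real.exp (-z.τh / m.βh - z.τc / m.βc)

/-- The block matrix `[[V⁻¹ + τ_h I, V⁻¹], [V⁻¹, V⁻¹ + τ_c (Q + δ I)]]`. For `δ = 0` this is the
precision matrix `C(τ_h, τ_c)`. -/
def C (δ τh τc : ℝ) : Matrix (Fin N ⊕ Fin N) (Fin N ⊕ Fin N) ℝ :=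
  Matrix.fromBlocks (m.Vinv + τh • 1) m.Vinv m.Vinv (m.Vinv + τc • (m.Q + δ • 1))

/-- `D = (-2 μ̂ᵀ V⁻¹, -2 μ̂ᵀ V⁻¹)`. -/
def D : Effects N :=
  Sum.elim ((-2 : ℝ) • (m.μhat ᵥ* m.Vinv)) ((-2 : ℝ) • (m.μhat ᵥ* m.Vinv))

/-- The centre `μ_N = -C⁻¹ Dᵀ / 2` of the multivariate t distribution, where `Q` in `C` is replaced
by `Q + δ I`. -/
def centre (δ τh τc : ℝ) : Effects N := (-(1 / 2) : ℝ) • ((m.C δ τh τc)⁻¹ *ᵥ m.D)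

end PoissonMRF

/-- The density, up to its normalising constant, of the log-t distribution with `ν` degrees of
freedom, location `μ` and scale `σ`. -/
def logTDensity (ν : ℕ) (μ σ τ : ℝ) : ℝ :=
  1 / τ * (1 + 1 / (ν : ℝ) * ((Real.log τ - μ) / σ) ^ 2) ^ (-((ν : ℝ) + 1) / 2)

/-- The density at `x` of the multivariate t distribution with `ν` degrees of freedom, centre `c`
and positive definite inverse scale matrix `A`. -/
def multivariateTDensity {ι : Type*} [Fintype ι] [DecidableEq ι] (ν : ℕ) (c : ι → ℝ)
    (A : Matrix ι ι ℝ) (x : ι → ℝ) : ℝ :=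
  A.det ^ (1 / 2 : ℝ) * Real.Gamma (((ν : ℝ) + Fintype.card ι) / 2) /
      (((ν : ℝ) * Real.pi) ^ ((Fintype.card ι : ℝ) / 2) * Real.Gamma ((ν : ℝ) / 2)) *
    (1 + 1 / (ν : ℝ) * ((x - c) ⬝ᵥ (A *ᵥ (x - c)))) ^ (-((ν : ℝ) + Fintype.card ι) / 2)

namespace PoissonMRF

variable {N : ℕ} (m : PoissonMRF N) (s : ProposalParams)

/-- The proposal density `r(τ_h, τ_c, Θ) = r₁(τ_h, τ_c) r₂(Θ ∣ τ_h, τ_c)`, up to its normalising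
constant, with `r₁` a product of two log-t densities and `r₂` a multivariate t density. -/
def proposalDensity (z : State N) : ℝ :=
  (logTDensity s.νh s.μh s.σh z.τh * logTDensity s.νc s.μc s.σc z.τc) *
    multivariateTDensity s.νr (m.centre s.δ z.τh z.τc) (m.C 0 z.τh z.τc) z.Θ

/-- The posterior distribution `π`. -/
def posterior : Measure (State N) := normalizedMeasure (State.lebesgue N) m.posteriorDensity

/-- The proposal distribution `r`. -/
def proposal : Measure (State N) := normalizedMeasure (State.lebesgue N) (m.proposalDensity s)

lemma measurable_posteriorDensity : Measurable m.posteriorDensity := by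
  have h : ∀ i, Measurable fun z : State N => z.θ i := fun i => by fun_prop
  have h' : ∀ i, Measurable fun z : State N => z.φ i := fun i => by fun_prop
  unfold posteriorDensity
  simp only [dotProduct, Matrix.mulVec]
  fun_prop

lemma measurable_C_apply (δ : ℝ) (i j : Fin N ⊕ Fin N) :
    Measurable fun z : State N => m.C δ z.τh z.τc i j := by
  rcases i with i | i <;> rcases j with j | j <;>
    simp only [C, Matrix.fromBlocks_apply₁₁, Matrix.fromBlocks_apply₁₂, Matrix.fromBlocks_apply₂₁,
      Matrix.fromBlocks_apply₂₂, Matrix.add_apply, Matrix.smul_apply, smul_eq_mul] <;>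
    fun_prop

lemma measurable_det {Ω ι : Type*} [MeasurableSpace Ω] [Fintype ι] [DecidableEq ι]
    {A : Ω → Matrix ι ι ℝ} (hA : ∀ i j, Measurable fun z => A z i j) :
    Measurable fun z => (A z).det := by
  simp only [Matrix.det_apply']
  fun_prop

lemma measurable_inv_apply {Ω ι : Type*} [MeasurableSpace Ω] [Fintype ι] [DecidableEq ι]
    {A : Ω → Matrix ι ι ℝ} (hA : ∀ i j, Measurable fun z => A z i j) (i j : ι) :
    Measurable fun z => (A z)⁻¹ i j := by
  simp only [Matrix.inv_def, Matrix.smul_apply, smul_eq_mul, Ring.inverse_eq_inv',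
    Matrix.adjugate_apply]
  refine (measurable_det hA).inv.mul (measurable_det fun k l => ?_)
  by_cases hk : k = j
  · subst hk
    simp
  · simpa [Matrix.updateRow_ne hk] using hA k l

lemma measurable_proposalDensity : Measurable (m.proposalDensity s) := by
  have hC := m.measurable_C_apply (N := N) 0
  have hinv := measurable_inv_apply (m.measurable_C_apply (N := N) s.δ)
  have hx : ∀ i, Measurable fun z : State N => (z.Θ - m.centre s.δ z.τh z.τc) i := fun i => by
    simp only [Pi.sub_apply, centre, Pi.smul_apply, Matrix.mulVec, dotProduct, smul_eq_mul]
    refine Measurable.sub (by fun_prop) (Measurable.const_mul ?_ _)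
    exact Finset.measurable_fun_sum _ fun j _ => (hinv i j).mul_const _
  have hquad : Measurable fun z : State N => (z.Θ - m.centre s.δ z.τh z.τc) ⬝ᵥ
      (m.C 0 z.τh z.τc *ᵥ (z.Θ - m.centre s.δ z.τh z.τc)) := by
    simp only [Matrix.mulVec, dotProduct]
    exact Finset.measurable_fun_sum _ fun i _ => (hx i).mul
      (Finset.measurable_fun_sum _ fun j _ => (hC i j).mul (hx j))
  have hdet : Measurable fun z : State N => (m.C 0 z.τh z.τc).det := measurable_det hC
  unfold proposalDensity logTDensity multivariateTDensity
  refine Measurable.mul (by fun_prop) (Measurable.mul ?_ ?_)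
  · exact ((hdet.pow_const _).mul_const _).div_const _
  · exact ((hquad.const_mul _).const_add _).pow_const _

/-- The independence Metropolis-Hastings chain with target density `π` and proposal density `r`. -/
def mhChain : Kernel (State N) (State N) :=
  independenceMH (State.lebesgue N) m.posteriorDensity (m.proposalDensity s)
    m.measurable_posteriorDensity (m.measurable_proposalDensity s)

end PoissonMRF

end

/-!
The chain proposes moves independently of its current state, so everything follows from a bound
`posterior ≤ K * proposal` between the unnormalised densities. Such a bound makes the posterior
integrable and the one-step laws dominate a fixed multiple of the posterior
(`minorization_independenceMH`); the posterior is invariant by detailed balance, and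
Doeblin's theorem (`uniformlyErgodic_of_minorization`) gives a geometric rate independent of the
starting point.

For the bound, the quadratic form of `C = C₀(τ_h, τ_c)` at `Θ = (θ, φ)` is `S + W`, with
`S = ∑ Yᵢ (θᵢ + φᵢ)²` from the likelihood and `W = τ_h |θ|² + τ_c φᵀ Q φ` from the priors.

* The centre `μ_N` has `μ_Nᵀ C μ_N ≤ ∑ Yᵢ μ̂ᵢ²` for all `τ_h, τ_c` (`centre_form_le`), hence the
  base of the multivariate t density is at most a constant times `(1 + S) (1 + W)`.
* Powers of `1 + S` are absorbed by the likelihood: since `Yᵢ > 0`, each `Yᵢ η - Eᵢ exp η` tends to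
  `-∞` at least linearly at both ends. Powers of `1 + W` are absorbed by `exp (-W / 2)`.
* Dropping `τ_c Q` from `C` gives `det C ≥ τ_hᴺ ∏ Yᵢ` (`le_det_C`), whatever the number of connected
  components of the graph, so `(det C) ^ (1/2)` dominates the factor `τ_h ^ (N/2)` of the posterior.
* What is left, `τ_h ^ (α_h - 1) exp (-τ_h / β_h)` and
  `τ_c ^ ((N - 1)/2 + α_c - 1) exp (-τ_c / β_c)`, is dominated by the log-t densities. Only here is
  `N ≥ 1` needed, to have `(N - 1)/2 + α_c > 0`.

The proposal is integrable because its conditional mass in `Θ` is a constant, by a linear change of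
variables, and the log-t densities become Student densities in the variable `log τ`.
-/

/-! ### Uniform ergodicity of independence chains with bounded weights -/

section IndependenceChain

variable {Ω : Type*} [MeasurableSpace Ω]

lemma isProbabilityMeasure_normalizedMeasure {lam : Measure Ω} {f : Ω → ℝ}
    (h0 : ∫⁻ x, ENNReal.ofReal (f x) ∂lam ≠ 0) (htop : ∫⁻ x, ENNReal.ofReal (f x) ∂lam ≠ ∞) :
    IsProbabilityMeasure (normalizedMeasure lam f) :=
  ⟨by simp [normalizedMeasure, ENNReal.inv_mul_cancel h0 htop]⟩

lemma setLIntegral_normalizedMeasure {lam : Measure Ω} {f : Ω → ℝ} (hf : Measurable f)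
    {g : Ω → ℝ≥0∞} (hg : Measurable g) {A : Set Ω} (hA : MeasurableSet A) :
    ∫⁻ x in A, g x ∂(normalizedMeasure lam f) =
      (∫⁻ x, ENNReal.ofReal (f x) ∂lam)⁻¹ * ∫⁻ x in A, ENNReal.ofReal (f x) * g x ∂lam := by
  rw [normalizedMeasure, Measure.restrict_smul, lintegral_smul_measure, restrict_withDensity hA,
    lintegral_withDensity_eq_lintegral_mul _ hf.ennreal_ofReal hg]
  rfl

lemma normalizedMeasure_apply (lam : Measure Ω) (f : Ω → ℝ) {A : Set Ω} (hA : MeasurableSet A) :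
    normalizedMeasure lam f A =
      (∫⁻ x, ENNReal.ofReal (f x) ∂lam)⁻¹ * ∫⁻ x in A, ENNReal.ofReal (f x) ∂lam := by
  rw [normalizedMeasure, Measure.smul_apply, withDensity_apply _ hA, smul_eq_mul]

/-- Doeblin's theorem: a Markov kernel whose one-step laws all dominate the same multiple
`ε • μ` of an invariant probability measure `μ` is uniformly ergodic, with rate `1 - ε`. -/
theorem uniformlyErgodic_of_minorization {P : Kernel Ω Ω} [IsMarkovKernel P] {μ : Measure Ω}
    [IsProbabilityMeasure μ] (hinv : P.Invariant μ) {ε : ℝ} (hε0 : 0 < ε) (hε1 : ε < 1)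
    (hmin : ∀ x, ENNReal.ofReal ε • μ ≤ P x) : UniformlyErgodic P μ := by
  have hpow : ∀ n : ℕ, IsMarkovKernel (P ^ n) ∧ (P ^ n).Invariant μ := by
    intro n
    induction n with
    | zero => exact ⟨inferInstanceAs (IsMarkovKernel Kernel.id), Measure.id_comp⟩
    | succ n ih =>
      have := ih.1
      rw [pow_succ]
      exact ⟨inferInstanceAs (IsMarkovKernel ((P ^ n).comp P)), ih.2.comp hinv⟩
  have ht : 0 < 1 - ε := by linarith
  -- Splitting `P x` as `ε • μ` plus a remainder of mass `1 - ε`, the part `ε • μ` is at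
  -- equilibrium for ever; this gives a one-sided bound by induction.
  have hlow : ∀ (n : ℕ) (x : Ω) (A : Set Ω), MeasurableSet A →
      ENNReal.ofReal (1 - (1 - ε) ^ n) * μ A ≤ (P ^ n) x A := by
    intro n
    induction n with
    | zero => intro x A _; simp
    | succ n ih =>
      intro x A hA
      have htn : (1 - ε) ^ n ≤ 1 := pow_le_one₀ ht.le (by linarith)
      set ρ := P x - ENNReal.ofReal ε • μ with hρ
      have hfin : IsFiniteMeasure (ENNReal.ofReal ε • μ) :=
        Measure.smul_finite _ ENNReal.ofReal_ne_top
      have hsplit : P x = ρ + ENNReal.ofReal ε • μ :=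
        (Measure.sub_add_cancel_of_le (hmin x)).symm
      have hρu : ρ Set.univ = ENNReal.ofReal (1 - ε) := by
        rw [hρ, Measure.sub_apply .univ (hmin x)]
        simp [ENNReal.ofReal_sub _ hε0.le]
      have hstep : (P ^ (n + 1)) x A = ∫⁻ y, (P ^ n) y A ∂(P x) := by
        rw [add_comm, Kernel.pow_add_apply_eq_lintegral _ _ _ _ hA, pow_one]
      have hstat : ∫⁻ y, (P ^ n) y A ∂μ = μ A := by
        rw [← Measure.bind_apply hA (Kernel.aemeasurable _), (hpow n).2.def]
      rw [hstep, hsplit, lintegral_add_measure, lintegral_smul_measure, hstat]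
      calc ENNReal.ofReal (1 - (1 - ε) ^ (n + 1)) * μ A
          = ENNReal.ofReal (1 - (1 - ε) ^ n) * μ A * ENNReal.ofReal (1 - ε) +
              ENNReal.ofReal ε * μ A := by
            rw [mul_right_comm, ← ENNReal.ofReal_mul (by linarith), ← add_mul,
              ← ENNReal.ofReal_add (mul_nonneg (by linarith) ht.le) hε0.le]
            congr 2
            ring
        _ = ∫⁻ _, ENNReal.ofReal (1 - (1 - ε) ^ n) * μ A ∂ρ + ENNReal.ofReal ε * μ A := by
            rw [lintegral_const, hρu]
        _ ≤ _ := by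
            gcongr with y
            · exact ih y A hA
            · rfl
  have hlow' : ∀ (n : ℕ) (x : Ω) (A : Set Ω), MeasurableSet A →
      μ.real A - (1 - ε) ^ n ≤ ((P ^ n) x).real A := by
    intro n x A hA
    have := (hpow n).1
    have htn : (1 - ε) ^ n ≤ 1 := pow_le_one₀ ht.le (by linarith)
    have h := ENNReal.toReal_mono (measure_ne_top _ _) (hlow n x A hA)
    rw [ENNReal.toReal_mul, ENNReal.toReal_ofReal (by linarith)] at h
    change (1 - (1 - ε) ^ n) * μ.real A ≤ ((P ^ n) x).real A at h
    have h1 : μ.real A ≤ 1 := measureReal_le_one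
    nlinarith [pow_pos ht n]
  refine ⟨1, 1 - ε, ht, by linarith, fun x n => ?_⟩
  have := (hpow n).1
  have : Nonempty {A : Set Ω // MeasurableSet A} := ⟨⟨∅, .empty⟩⟩
  refine ciSup_le fun A => ?_
  rw [one_mul, abs_le]
  have h1 := hlow' n x A.1 A.2
  have h2 := hlow' n x A.1ᶜ A.2.compl
  rw [probReal_compl_eq_one_sub A.2, probReal_compl_eq_one_sub A.2] at h2
  constructor <;> linarith

variable {lam : Measure Ω} [SFinite lam] {p q : Ω → ℝ}

omit [MeasurableSpace Ω] in
lemma acceptProb_le_one (p q : Ω → ℝ) (x y : Ω) : acceptProb p q x y ≤ 1 := min_le_left _ _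

omit [MeasurableSpace Ω] in
lemma mul_acceptProb (hp : ∀ x, 0 < p x) (hq : ∀ x, 0 < q x) (x y : Ω) :
    p x * q y * acceptProb p q x y = min (p x * q y) (p y * q x) := by
  have h : 0 < p x * q y := mul_pos (hp x) (hq y)
  rw [acceptProb, mul_min_of_nonneg _ _ h.le, mul_one, mul_div_cancel₀ _ h.ne']

lemma measurable_acceptProb (hp : Measurable p) (hq : Measurable q) :
    Measurable fun z : Ω × Ω => ENNReal.ofReal (acceptProb p q z.1 z.2) := by
  unfold acceptProb
  fun_prop

lemma independenceMH_apply (hp : Measurable p) (hq : Measurable q) (x : Ω) {A : Set Ω}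
    (hA : MeasurableSet A) :
    independenceMH lam p q hp hq x A =
      ∫⁻ y in A, ENNReal.ofReal (acceptProb p q x y) ∂(normalizedMeasure lam q) +
        (1 - ∫⁻ y, ENNReal.ofReal (acceptProb p q x y) ∂(normalizedMeasure lam q)) *
          A.indicator 1 x := by
  change ((normalizedMeasure lam q).withDensity _ + _ • Measure.dirac x) A = _
  rw [Measure.add_apply, Measure.smul_apply, withDensity_apply _ hA, Measure.dirac_apply' _ hA,
    smul_eq_mul]

lemma isMarkovKernel_independenceMH (hp : Measurable p) (hq : Measurable q)
    [IsProbabilityMeasure (normalizedMeasure lam q)] :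
    IsMarkovKernel (independenceMH lam p q hp hq) := by
  refine ⟨fun x => ⟨?_⟩⟩
  rw [independenceMH_apply hp hq x .univ]
  have h : ∫⁻ y, ENNReal.ofReal (acceptProb p q x y) ∂(normalizedMeasure lam q) ≤ 1 :=
    calc ∫⁻ y, ENNReal.ofReal (acceptProb p q x y) ∂(normalizedMeasure lam q)
        ≤ ∫⁻ _, 1 ∂(normalizedMeasure lam q) :=
          lintegral_mono fun y => ENNReal.ofReal_le_one.2 (acceptProb_le_one p q x y)
      _ = 1 := by simp
  simp [add_tsub_cancel_of_le h]

/-- Detailed balance. The accepted moves have joint density proportional to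
`min (p x * q y) (p y * q x)`, which is symmetric. -/
lemma isReversible_independenceMH (hp : Measurable p) (hq : Measurable q)
    (hp0 : ∀ x, 0 < p x) (hq0 : ∀ x, 0 < q x) :
    (independenceMH lam p q hp hq).IsReversible (normalizedMeasure lam p) := by
  have ha := measurable_acceptProb hp hq
  have ha' : ∀ x, Measurable fun y => ENNReal.ofReal (acceptProb p q x y) := fun x =>
    ha.comp measurable_prodMk_left
  have hflow : ∀ A B : Set Ω, MeasurableSet A → MeasurableSet B →
      ∫⁻ x in A, ∫⁻ y in B, ENNReal.ofReal (acceptProb p q x y) ∂(normalizedMeasure lam q)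
          ∂(normalizedMeasure lam p) =
        (∫⁻ x, ENNReal.ofReal (p x) ∂lam)⁻¹ * ((∫⁻ x, ENNReal.ofReal (q x) ∂lam)⁻¹ *
          ∫⁻ x in A, ∫⁻ y in B, ENNReal.ofReal (min (p x * q y) (p y * q x)) ∂lam ∂lam) := by
    intro A B hA hB
    rw [setLIntegral_normalizedMeasure hp ha.lintegral_prod_right' hA]
    congr 1
    have hm : Measurable fun z : Ω × Ω => ENNReal.ofReal (min (p z.1 * q z.2) (p z.2 * q z.1)) := by
      fun_prop
    rw [← lintegral_const_mul _ hm.lintegral_prod_right']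
    refine lintegral_congr fun x => ?_
    rw [setLIntegral_normalizedMeasure hq (ha' x) hB, mul_left_comm]
    congr 1
    rw [← lintegral_const_mul _ (by fun_prop)]
    refine lintegral_congr fun y => ?_
    rw [← mul_acceptProb hp0 hq0, ENNReal.ofReal_mul (mul_pos (hp0 x) (hq0 y)).le,
      ENNReal.ofReal_mul (hp0 x).le, mul_assoc]
  have hstay : ∀ A B : Set Ω, MeasurableSet B → ∀ c : Ω → ℝ≥0∞,
      ∫⁻ x in A, c x * B.indicator 1 x ∂(normalizedMeasure lam p) =
        ∫⁻ x in B ∩ A, c x ∂(normalizedMeasure lam p) := by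
    intro A B hB c
    rw [← Measure.restrict_restrict hB, ← lintegral_indicator hB]
    refine lintegral_congr fun x => ?_
    by_cases h : x ∈ B <;> simp [h]
  intro A B hA hB
  simp only [independenceMH_apply hp hq _ hA, independenceMH_apply hp hq _ hB]
  rw [lintegral_add_left ha.lintegral_prod_right', lintegral_add_left ha.lintegral_prod_right',
    hflow A B hA hB, hflow B A hB hA, hstay A B hB, hstay B A hA, Set.inter_comm]
  congr 3
  rw [lintegral_lintegral_swap (by fun_prop)]
  simp only [min_comm]

/-- A uniform bound `p ≤ K * q` on the importance weights makes every accepted density at least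
`p y / K`, whatever the current state: this is the minorisation condition. -/
lemma minorization_independenceMH (hp : Measurable p) (hq : Measurable q)
    (hp0 : ∀ x, 0 < p x) (hq0 : ∀ x, 0 < q x) {K : ℝ} (hK : 0 < K) (hle : ∀ x, p x ≤ K * q x)
    (hZ0 : ∫⁻ x, ENNReal.ofReal (p x) ∂lam ≠ 0) (hZ : ∫⁻ x, ENNReal.ofReal (p x) ∂lam ≠ ∞)
    (x : Ω) :
    (ENNReal.ofReal K⁻¹ * (∫⁻ x, ENNReal.ofReal (p x) ∂lam) *
      (∫⁻ x, ENNReal.ofReal (q x) ∂lam)⁻¹) • normalizedMeasure lam p ≤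
        independenceMH lam p q hp hq x := by
  refine Measure.le_iff.2 fun A hA => ?_
  have ha : Measurable fun y => ENNReal.ofReal (acceptProb p q x y) :=
    (measurable_acceptProb hp hq).comp measurable_prodMk_left
  rw [independenceMH_apply hp hq x hA, setLIntegral_normalizedMeasure hq ha hA,
    Measure.smul_apply, normalizedMeasure_apply _ _ hA, smul_eq_mul]
  refine le_trans ?_ le_self_add
  set Zp := ∫⁻ x, ENNReal.ofReal (p x) ∂lam
  set Zq := ∫⁻ x, ENNReal.ofReal (q x) ∂lam
  calc ENNReal.ofReal K⁻¹ * Zp * Zq⁻¹ * (Zp⁻¹ * ∫⁻ y in A, ENNReal.ofReal (p y) ∂lam)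
      = Zp * Zp⁻¹ * (Zq⁻¹ * (ENNReal.ofReal K⁻¹ * ∫⁻ y in A, ENNReal.ofReal (p y) ∂lam)) := by ring
    _ = Zq⁻¹ * ∫⁻ y in A, ENNReal.ofReal K⁻¹ * ENNReal.ofReal (p y) ∂lam := by
      rw [ENNReal.mul_inv_cancel hZ0 hZ, one_mul, lintegral_const_mul _ (by fun_prop)]
    _ ≤ _ := by
      refine mul_le_mul' le_rfl (lintegral_mono fun y => ?_)
      rw [← ENNReal.ofReal_mul (inv_pos.2 hK).le, ← ENNReal.ofReal_mul (hq0 y).le]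
      refine ENNReal.ofReal_le_ofReal (le_of_mul_le_mul_left ?_ (hp0 x))
      rw [← mul_assoc (p x) (q y), mul_acceptProb hp0 hq0]
      refine le_min (mul_le_mul_of_nonneg_left ?_ (hp0 x).le) ?_
      · rw [inv_mul_le_iff₀ hK]
        exact hle y
      · rw [mul_left_comm, inv_mul_le_iff₀ hK]
        nlinarith [hle x, hp0 y]

/-- An independence Metropolis-Hastings chain whose importance weights `p / q` are bounded is
uniformly ergodic; the bound also makes `p` integrable. -/
theorem independenceMH_of_bounded_weights (hp : Measurable p) (hq : Measurable q)
    (hp0 : ∀ x, 0 < p x) (hq0 : ∀ x, 0 < q x) {K : ℝ} (hK : 0 < K) (hle : ∀ x, p x ≤ K * q x)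
    (hlam : lam ≠ 0) (hqfin : ∫⁻ x, ENNReal.ofReal (q x) ∂lam ≠ ∞) :
    IsProbabilityMeasure (normalizedMeasure lam p) ∧
      IsProbabilityMeasure (normalizedMeasure lam q) ∧
      IsMarkovKernel (independenceMH lam p q hp hq) ∧
      (independenceMH lam p q hp hq).Invariant (normalizedMeasure lam p) ∧
      UniformlyErgodic (independenceMH lam p q hp hq) (normalizedMeasure lam p) := by
  have hne : ∀ f : Ω → ℝ, Measurable f → (∀ x, 0 < f x) →
      ∫⁻ x, ENNReal.ofReal (f x) ∂lam ≠ 0 := by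
    intro f hf hf0 h
    rw [lintegral_eq_zero_iff hf.ennreal_ofReal] at h
    refine hlam (ae_eq_bot.1 (Filter.empty_mem_iff_bot.1 ?_))
    filter_upwards [h] with x hx
    exact absurd (ENNReal.ofReal_eq_zero.1 hx) (hf0 x).not_ge
  have hpfin : ∫⁻ x, ENNReal.ofReal (p x) ∂lam ≠ ∞ := by
    refine ne_top_of_le_ne_top (b := ENNReal.ofReal K * ∫⁻ x, ENNReal.ofReal (q x) ∂lam)
      (ENNReal.mul_ne_top ENNReal.ofReal_ne_top hqfin) ?_
    rw [← lintegral_const_mul _ hq.ennreal_ofReal]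
    refine lintegral_mono fun x => ?_
    rw [← ENNReal.ofReal_mul hK.le]
    exact ENNReal.ofReal_le_ofReal (hle x)
  have hπ := isProbabilityMeasure_normalizedMeasure (hne p hp hp0) hpfin
  have hr := isProbabilityMeasure_normalizedMeasure (hne q hq hq0) hqfin
  have hM := isMarkovKernel_independenceMH (lam := lam) hp hq
  have hinv := (isReversible_independenceMH (lam := lam) hp hq hp0 hq0).invariant
  refine ⟨hπ, hr, hM, hinv, ?_⟩
  set ε := ENNReal.ofReal K⁻¹ * (∫⁻ x, ENNReal.ofReal (p x) ∂lam) *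
      (∫⁻ x, ENNReal.ofReal (q x) ∂lam)⁻¹ with hε
  have hε_top : ε ≠ ∞ := ENNReal.mul_ne_top (ENNReal.mul_ne_top ENNReal.ofReal_ne_top hpfin)
    (ENNReal.inv_ne_top.2 (hne q hq hq0))
  have hε_zero : ε ≠ 0 := mul_ne_zero (mul_ne_zero (by simpa using hK) (hne p hp hp0))
    (ENNReal.inv_ne_zero.2 hqfin)
  refine uniformlyErgodic_of_minorization hinv (ε := min ε.toReal (1 / 2))
    (lt_min (ENNReal.toReal_pos hε_zero hε_top) (by norm_num))
    ((min_le_right _ _).trans_lt (by norm_num)) fun x => ?_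
  refine le_trans ?_
    (minorization_independenceMH hp hq hp0 hq0 hK hle (hne p hp hp0) hpfin x)
  refine Measure.le_iff.2 fun A _ => ?_
  simp only [Measure.smul_apply, smul_eq_mul]
  gcongr
  exact ENNReal.ofReal_le_of_le_toReal (min_le_left _ _)

end IndependenceChain

/-! ### Positive definite matrices -/

namespace Matrix

variable {n : Type*} [Fintype n] [DecidableEq n]

lemma one_le_det_one_add {P : Matrix n n ℝ} (hP : P.PosSemidef) : 1 ≤ (1 + P).det := by
  have hH : (1 + P).IsHermitian := isHermitian_one.add hP.1
  rw [hH.det_eq_prod_eigenvalues]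
  refine Finset.one_le_prod fun i _ => ?_
  have hv : star ⇑(hH.eigenvectorBasis i) ⬝ᵥ ⇑(hH.eigenvectorBasis i) = 1 := by
    rw [dotProduct_comm, ← EuclideanSpace.inner_eq_star_dotProduct, real_inner_self_eq_norm_sq,
      hH.eigenvectorBasis.norm_eq_one, one_pow]
  change 1 ≤ hH.eigenvalues i
  rw [hH.eigenvalues_eq, add_mulVec, one_mulVec, dotProduct_add, hv, RCLike.re_to_real]
  exact le_add_of_nonneg_right (hP.dotProduct_mulVec_nonneg _)

open scoped MatrixOrder in
lemma PosSemidef.exists_transpose_mul_self {A : Matrix n n ℝ} (hA : A.PosSemidef) :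
    ∃ B : Matrix n n ℝ, A = Bᵀ * B := by
  refine ⟨CFC.sqrt A, ?_⟩
  have h := CFC.sqrt_mul_sqrt_self A hA.nonneg
  have h2 : (CFC.sqrt A).IsHermitian := (nonneg_iff_posSemidef.1 (CFC.sqrt_nonneg A)).1
  rw [IsHermitian, conjTranspose_eq_transpose_of_trivial] at h2
  rw [h2, h]

/-- The determinant is monotone for the Loewner order. -/
lemma PosDef.det_le_det_add {A P : Matrix n n ℝ} (hA : A.PosDef) (hP : P.PosSemidef) :
    A.det ≤ (A + P).det := by
  obtain ⟨B, rfl⟩ := hA.posSemidef.exists_transpose_mul_self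
  have hB : IsUnit B.det := by
    have := hA.det_pos.ne'
    rw [det_mul] at this
    exact (right_ne_zero_of_mul this).isUnit
  have hfac : Bᵀ * B + P = Bᵀ * (1 + (B⁻¹)ᵀ * P * B⁻¹) * B := by
    have h1 : Bᵀ * (B⁻¹)ᵀ = 1 := by rw [← transpose_mul, nonsing_inv_mul _ hB, transpose_one]
    have h2 : B⁻¹ * B = 1 := nonsing_inv_mul _ hB
    calc Bᵀ * B + P = Bᵀ * B + (Bᵀ * (B⁻¹)ᵀ) * P * (B⁻¹ * B) := by simp [h1, h2]
      _ = _ := by noncomm_ring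
  have hP' : ((B⁻¹)ᵀ * P * B⁻¹).PosSemidef := by
    simpa using hP.conjTranspose_mul_mul_same B⁻¹
  rw [hfac, det_mul, det_mul, det_mul, mul_right_comm]
  refine le_mul_of_one_le_right ?_ (one_le_det_one_add hP')
  rw [det_transpose]
  exact mul_self_nonneg _

omit [DecidableEq n] in
lemma PosSemidef.dotProduct_mulVec_sub_le {A : Matrix n n ℝ} (hA : A.PosSemidef) (x c : n → ℝ) :
    (x - c) ⬝ᵥ (A *ᵥ (x - c)) ≤ 2 * (x ⬝ᵥ (A *ᵥ x)) + 2 * (c ⬝ᵥ (A *ᵥ c)) := by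
  have h := hA.dotProduct_mulVec_nonneg (x + c)
  rw [star_trivial] at h
  simp only [mulVec_add, mulVec_sub, dotProduct_add, add_dotProduct, dotProduct_sub,
    sub_dotProduct] at h ⊢
  linarith

end Matrix

/-! ### The precision matrix -/

namespace PoissonMRF

variable {N : ℕ} (m : PoissonMRF N)

lemma posSemidef_Q : m.Q.PosSemidef := by
  classical
  exact m.graph.posSemidef_lapMatrix ℝ

/-- The part `∑ Yᵢ (θᵢ + φᵢ)²` of the quadratic form of `C` that comes from the likelihood. -/
noncomputable def likelihoodForm (u : Effects N) : ℝ := ∑ i, m.Y i * (u (Sum.inl i) + u (Sum.inr i)) ^ 2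

/-- The part `τ_h |θ|² + τ_c φᵀ Q φ` of the quadratic form of `C` that comes from the priors. -/
noncomputable def priorForm (τh τc : ℝ) (u : Effects N) : ℝ :=
  τh * ((u ∘ Sum.inl) ⬝ᵥ (u ∘ Sum.inl)) + τc * ((u ∘ Sum.inr) ⬝ᵥ (m.Q *ᵥ (u ∘ Sum.inr)))

lemma likelihoodForm_nonneg (u : Effects N) : 0 ≤ m.likelihoodForm u :=
  Finset.sum_nonneg fun i _ => mul_nonneg (m.Y_pos i).le (sq_nonneg _)

lemma priorForm_nonneg {τh τc : ℝ} (hh : 0 ≤ τh) (hc : 0 ≤ τc) (u : Effects N) :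
    0 ≤ m.priorForm τh τc u := by
  have h := m.posSemidef_Q.dotProduct_mulVec_nonneg (u ∘ Sum.inr)
  rw [star_trivial] at h
  exact add_nonneg (mul_nonneg hh (dotProduct_self_star_nonneg (u ∘ Sum.inl))) (mul_nonneg hc h)

lemma dotProduct_C_mulVec (δ τh τc : ℝ) (u : Effects N) :
    u ⬝ᵥ (m.C δ τh τc *ᵥ u) = m.likelihoodForm u + m.priorForm τh τc u +
      τc * δ * ((u ∘ Sum.inr) ⬝ᵥ (u ∘ Sum.inr)) := by
  have h : m.likelihoodForm u = (u ∘ Sum.inl) ⬝ᵥ (m.Vinv *ᵥ (u ∘ Sum.inl)) +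
      (u ∘ Sum.inl) ⬝ᵥ (m.Vinv *ᵥ (u ∘ Sum.inr)) + (u ∘ Sum.inr) ⬝ᵥ (m.Vinv *ᵥ (u ∘ Sum.inl)) +
      (u ∘ Sum.inr) ⬝ᵥ (m.Vinv *ᵥ (u ∘ Sum.inr)) := by
    simp only [likelihoodForm, dotProduct, Vinv, Matrix.mulVec_diagonal, Function.comp_apply,
      ← Finset.sum_add_distrib]
    exact Finset.sum_congr rfl fun i _ => by ring
  rw [h, priorForm, C, Matrix.fromBlocks_mulVec]
  conv_lhs => rw [← Sum.elim_comp_inl_inr u]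
  rw [Sum.elim_comp_inl, Sum.elim_comp_inr, sumElim_dotProduct_sumElim]
  simp only [Matrix.add_mulVec, Matrix.smul_mulVec, Matrix.one_mulVec, dotProduct_add,
    dotProduct_smul, smul_eq_mul]
  ring

lemma isHermitian_C (δ τh τc : ℝ) : (m.C δ τh τc).IsHermitian := by
  have hV : m.Vinv.IsHermitian := Matrix.isHermitian_diagonal _
  have hone : (1 : Matrix (Fin N) (Fin N) ℝ).IsHermitian := Matrix.isHermitian_one
  refine Matrix.IsHermitian.fromBlocks (hV.add ?_) hV (hV.add ?_)
  · exact hone.smul (IsSelfAdjoint.all _)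
  · exact (m.posSemidef_Q.1.add (hone.smul (IsSelfAdjoint.all _))).smul (IsSelfAdjoint.all _)

lemma posDef_C {δ τh τc : ℝ} (hδ : 0 ≤ δ) (hh : 0 < τh) (hc : 0 ≤ τc) : (m.C δ τh τc).PosDef := by
  refine .of_dotProduct_mulVec_pos (m.isHermitian_C δ τh τc) fun u hu => ?_
  rw [star_trivial, dotProduct_C_mulVec]
  have h1 := m.likelihoodForm_nonneg u
  have h2 := m.posSemidef_Q.dotProduct_mulVec_nonneg (u ∘ Sum.inr)
  rw [star_trivial] at h2
  have h3 : 0 ≤ (u ∘ Sum.inr) ⬝ᵥ (u ∘ Sum.inr) := dotProduct_self_star_nonneg _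
  have h4 : 0 ≤ (u ∘ Sum.inl) ⬝ᵥ (u ∘ Sum.inl) := dotProduct_self_star_nonneg _
  have h5 := mul_nonneg hc h2
  have h6 := mul_nonneg (mul_nonneg hc hδ) h3
  rw [priorForm]
  rcases h4.eq_or_lt with h0 | h0
  · -- if `θ = 0` then `φ ≠ 0` and the likelihood part does not vanish
    have hθ : u ∘ Sum.inl = 0 := dotProduct_self_eq_zero.1 h0.symm
    obtain ⟨i, hi⟩ : ∃ i, u (Sum.inr i) ≠ 0 := by
      by_contra! h
      exact hu (funext (Sum.rec (congrFun hθ) h))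
    have : 0 < m.likelihoodForm u := by
      refine Finset.sum_pos' (fun i _ => mul_nonneg (m.Y_pos i).le (sq_nonneg _))
        ⟨i, Finset.mem_univ _, mul_pos (m.Y_pos i) ?_⟩
      have := congrFun hθ i
      simp only [Function.comp_apply, Pi.zero_apply] at this
      rw [this, zero_add]
      positivity
    rw [← h0]
    linarith
  · have := mul_pos hh h0
    linarith

/-- Discarding the positive semidefinite contribution of `τ_c Q` bounds `det C` below, uniformly in
`τ_c`. -/
lemma le_det_C {τh τc : ℝ} (hh : 0 < τh) (hc : 0 ≤ τc) :
    (∏ i, m.Y i) * τh ^ N ≤ (m.C 0 τh τc).det := by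
  have hdet : (m.C 0 τh 0).det = (∏ i, m.Y i) * τh ^ N := by
    have hu : IsUnit m.Vinv.det := by
      rw [Vinv, Matrix.det_diagonal]
      exact (Finset.prod_pos fun i _ => m.Y_pos i).ne'.isUnit
    have := Matrix.invertibleOfIsUnitDet _ hu
    have hV : m.Vinv * ⅟m.Vinv * m.Vinv = m.Vinv := by simp
    rw [C, zero_smul, add_zero, Matrix.det_fromBlocks₂₂, hV, add_sub_cancel_left,
      Matrix.det_smul, Matrix.det_one, mul_one, Fintype.card_fin, Vinv, Matrix.det_diagonal]
  have hsplit : m.C 0 τh τc = m.C 0 τh 0 + Matrix.fromBlocks 0 0 0 (τc • m.Q) := by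
    simp [C, Matrix.fromBlocks_add]
  have hP : (Matrix.fromBlocks 0 0 0 (τc • m.Q) :
      Matrix (Fin N ⊕ Fin N) (Fin N ⊕ Fin N) ℝ).PosSemidef := by
    refine .of_dotProduct_mulVec_nonneg ?_ fun u => ?_
    · exact Matrix.IsHermitian.fromBlocks Matrix.isHermitian_zero (by simp)
        (m.posSemidef_Q.1.smul (IsSelfAdjoint.all _))
    · have h2 := m.posSemidef_Q.dotProduct_mulVec_nonneg (u ∘ Sum.inr)
      rw [star_trivial] at h2 ⊢
      rw [Matrix.fromBlocks_mulVec]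
      conv_rhs => rw [← Sum.elim_comp_inl_inr u]
      rw [Sum.elim_comp_inl, Sum.elim_comp_inr, sumElim_dotProduct_sumElim]
      simpa [Matrix.smul_mulVec] using mul_nonneg hc h2
  rw [← hdet, hsplit]
  exact (m.posDef_C le_rfl hh le_rfl).det_le_det_add hP

/-- The centre of the proposal stays bounded in the norm defined by `C`: it solves
`C_δ μ = V⁻¹ μ̂` (in both blocks), and the right-hand side only sees the likelihood part of the
quadratic form, so that completing the square bounds `μᵀ C_δ μ`, an upper bound of `μᵀ C μ`. -/
lemma centre_form_le {δ τh τc : ℝ} (hδ : 0 ≤ δ) (hh : 0 < τh) (hc : 0 ≤ τc) :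
    m.centre δ τh τc ⬝ᵥ (m.C 0 τh τc *ᵥ m.centre δ τh τc) ≤ ∑ i, m.Y i * m.μhat i ^ 2 := by
  set u := m.centre δ τh τc with hu
  have hCu : m.C δ τh τc *ᵥ u = (-(1 / 2) : ℝ) • m.D := by
    rw [hu, centre, Matrix.mulVec_smul, Matrix.mulVec_mulVec, Matrix.mul_nonsing_inv,
      Matrix.one_mulVec]
    exact (m.posDef_C hδ hh hc).det_pos.ne'.isUnit
  have h3 : 0 ≤ (u ∘ Sum.inr) ⬝ᵥ (u ∘ Sum.inr) := dotProduct_self_star_nonneg _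
  have h6 := mul_nonneg (mul_nonneg hc hδ) h3
  have h7 := m.priorForm_nonneg hh.le hc u
  have hD : u ⬝ᵥ ((-(1 / 2) : ℝ) • m.D) =
      ∑ i, m.Y i * m.μhat i * (u (Sum.inl i) + u (Sum.inr i)) := by
    simp only [D, dotProduct, Fintype.sum_sum_type, Pi.smul_apply, Sum.elim_inl, Sum.elim_inr,
      Vinv, Matrix.vecMul_diagonal, ← Finset.sum_add_distrib, smul_eq_mul]
    exact Finset.sum_congr rfl fun i _ => by ring
  have hform := m.dotProduct_C_mulVec δ τh τc u
  rw [hCu, hD] at hform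
  -- completing the square: `2 ∑ Y μ̂ η ≤ ∑ Y μ̂² + ∑ Y η²` with `η = θ + φ`
  have hcs : 2 * ∑ i, m.Y i * m.μhat i * (u (Sum.inl i) + u (Sum.inr i)) ≤
      (∑ i, m.Y i * m.μhat i ^ 2) + m.likelihoodForm u := by
    rw [likelihoodForm, Finset.mul_sum, ← Finset.sum_add_distrib]
    refine Finset.sum_le_sum fun i _ => ?_
    nlinarith [mul_nonneg (m.Y_pos i).le
      (sq_nonneg (m.μhat i - (u (Sum.inl i) + u (Sum.inr i))))]
  rw [m.dotProduct_C_mulVec 0 τh τc u]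
  linarith

end PoissonMRF

/-! ### Exponential decay against polynomial growth -/

lemma one_add_rpow_le_mul_exp {a k u : ℝ} (ha : 0 < a) (hk : 0 < k) (hu : 0 ≤ u) :
    (1 + u) ^ k ≤ (1 + k / a) ^ k * Real.exp (a * u) := by
  have h1 : 1 + u ≤ (1 + k / a) * Real.exp (a * u / k) := by
    have h2 := Real.add_one_le_exp (a * u / k)
    have h3 : (1 + k / a) * (a * u / k + 1) = 1 + u + (a * u / k + k / a) := by
      field_simp
      ring
    have h4 : 0 ≤ a * u / k + k / a := by positivity
    have h5 := mul_le_mul_of_nonneg_left h2 (show 0 ≤ 1 + k / a by positivity)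
    linarith
  calc (1 + u) ^ k ≤ ((1 + k / a) * Real.exp (a * u / k)) ^ k :=
        Real.rpow_le_rpow (by positivity) h1 hk.le
    _ = (1 + k / a) ^ k * Real.exp (a * u) := by
        rw [Real.mul_rpow (by positivity) (Real.exp_pos _).le, ← Real.exp_mul,
          div_mul_cancel₀ _ hk.ne']

/-- The density of the logarithm of a gamma variable decays faster than any power, at both ends. -/
lemma exists_exp_sub_exp_mul_rpow_le {a b k c : ℝ} (ha : 0 < a) (hb : 0 < b) (hk : 0 < k)
    (hc : 0 ≤ c) (μ : ℝ) :
    ∃ K, 0 < K ∧ ∀ x : ℝ,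
      Real.exp (a * x - b * Real.exp x) * (1 + c * (x - μ) ^ 2) ^ k ≤ K := by
  set M := 1 + 2 * c + 2 * c * μ ^ 2 with hM
  have hM0 : 0 < M := by positivity
  refine ⟨Real.exp (2 * a ^ 2 / b) * (M ^ k * (1 + 2 * k / a) ^ (2 * k)), by positivity,
    fun x => ?_⟩
  have h1 : a * x - b * Real.exp x ≤ 2 * a ^ 2 / b - a * |x| := by
    rcases le_total 0 x with hx | hx
    · rw [abs_of_nonneg hx]
      have h := mul_le_mul_of_nonneg_left (Real.quadratic_le_exp_of_nonneg hx) hb.le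
      have h2 : 2 * a ^ 2 / b - a * x - (a * x - b * (x ^ 2 / 2)) =
          b / 2 * (x - 2 * a / b) ^ 2 := by
        field_simp
        ring
      have h3 : 0 ≤ b / 2 * (x - 2 * a / b) ^ 2 := by positivity
      nlinarith [mul_nonneg hb.le hx]
    · rw [abs_of_nonpos hx]
      have h2 : 0 ≤ 2 * a ^ 2 / b := by positivity
      nlinarith [mul_pos hb (Real.exp_pos x)]
  have h2 : 1 + c * (x - μ) ^ 2 ≤ M * (1 + |x|) ^ 2 := by
    have h3 : (x - μ) ^ 2 ≤ 2 * x ^ 2 + 2 * μ ^ 2 := by nlinarith [sq_nonneg (x + μ)]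
    have h4 : x ^ 2 ≤ (1 + |x|) ^ 2 := by rw [← sq_abs x]; gcongr; linarith
    have h5 : 1 ≤ (1 + |x|) ^ 2 := one_le_pow₀ (by linarith [abs_nonneg x])
    calc 1 + c * (x - μ) ^ 2 ≤ 1 * 1 + 2 * c * x ^ 2 + 2 * c * μ ^ 2 * 1 := by
          nlinarith [mul_le_mul_of_nonneg_left h3 hc]
      _ ≤ 1 * (1 + |x|) ^ 2 + 2 * c * (1 + |x|) ^ 2 + 2 * c * μ ^ 2 * (1 + |x|) ^ 2 := by gcongr
      _ = M * (1 + |x|) ^ 2 := by rw [hM]; ring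
  have h6 : (1 + c * (x - μ) ^ 2) ^ k ≤
      M ^ k * ((1 + 2 * k / a) ^ (2 * k) * Real.exp (a * |x|)) := by
    calc (1 + c * (x - μ) ^ 2) ^ k ≤ (M * (1 + |x|) ^ 2) ^ k :=
          Real.rpow_le_rpow (by positivity) h2 hk.le
      _ = M ^ k * (1 + |x|) ^ (2 * k) := by
          rw [Real.mul_rpow hM0.le (by positivity), Real.rpow_mul (by positivity),
            Real.rpow_two]
      _ ≤ _ := by
          gcongr
          exact one_add_rpow_le_mul_exp ha (by positivity) (abs_nonneg x)
  calc Real.exp (a * x - b * Real.exp x) * (1 + c * (x - μ) ^ 2) ^ k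
      ≤ Real.exp (2 * a ^ 2 / b - a * |x|) *
          (M ^ k * ((1 + 2 * k / a) ^ (2 * k) * Real.exp (a * |x|))) := by gcongr
    _ = Real.exp (2 * a ^ 2 / b) * (M ^ k * (1 + 2 * k / a) ^ (2 * k)) *
          (Real.exp (-(a * |x|)) * Real.exp (a * |x|)) := by
        rw [sub_eq_add_neg, Real.exp_add]
        ring
    _ = _ := by rw [← Real.exp_add, neg_add_cancel, Real.exp_zero, mul_one]

lemma one_add_sum_le_prod_one_add {ι : Type*} (s : Finset ι) {f : ι → ℝ} (hf : ∀ i, 0 ≤ f i) :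
    1 + ∑ i ∈ s, f i ≤ ∏ i ∈ s, (1 + f i) := by
  classical
  induction s using Finset.induction_on with
  | empty => simp
  | insert i s hi ih =>
    rw [Finset.sum_insert hi, Finset.prod_insert hi]
    have h := Finset.sum_nonneg fun j (_ : j ∈ s) => hf j
    nlinarith [mul_le_mul_of_nonneg_left ih (show 0 ≤ 1 + f i by linarith [hf i]),
      mul_nonneg (hf i) h]

/-! ### The log-t and multivariate t densities -/

lemma logTDensity_eq (ν : ℕ) (μ σ τ : ℝ) :
    logTDensity ν μ σ τ = 1 / τ *
      ((1 + 1 / (ν * σ ^ 2) * (Real.log τ - μ) ^ 2) ^ (((ν : ℝ) + 1) / 2))⁻¹ := by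
  have h : 1 / (ν : ℝ) * ((Real.log τ - μ) / σ) ^ 2 =
      1 / (ν * σ ^ 2) * (Real.log τ - μ) ^ 2 := by ring
  rw [logTDensity, h, neg_div, Real.rpow_neg (by positivity)]

/-- A gamma density is dominated by a log-t density. -/
lemma exists_rpow_mul_exp_le_logTDensity {a β σ : ℝ} (ha : 0 < a) (hβ : 0 < β) (ν : ℕ) (μ : ℝ) :
    ∃ K, 0 < K ∧ ∀ τ : ℝ, 0 < τ →
      τ ^ (a - 1) * Real.exp (-τ / β) ≤ K * logTDensity ν μ σ τ := by
  obtain ⟨K, hK, h⟩ := exists_exp_sub_exp_mul_rpow_le (k := ((ν : ℝ) + 1) / 2)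
    (c := 1 / (ν * σ ^ 2)) ha (inv_pos.2 hβ) (by positivity) (by positivity) μ
  refine ⟨K, hK, fun τ hτ => ?_⟩
  have h1 := h (Real.log τ)
  rw [← le_div_iff₀ (by positivity), Real.exp_log hτ] at h1
  rw [logTDensity_eq, mul_left_comm, ← div_eq_mul_inv]
  refine le_trans (le_of_eq ?_) (mul_le_mul_of_nonneg_left h1 (by positivity))
  rw [Real.rpow_sub_one hτ.ne', sub_eq_add_neg, Real.exp_add, mul_comm a, ← Real.rpow_def_of_pos hτ]
  have : -(β⁻¹ * τ) = -τ / β := by ring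
  rw [this]
  ring

/-- The normalising constant, free of the scale matrix, of the multivariate t density in dimension
`d`. -/
noncomputable def multivariateTConst (ν d : ℕ) : ℝ :=
  Real.Gamma (((ν : ℝ) + d) / 2) / (((ν : ℝ) * Real.pi) ^ ((d : ℝ) / 2) * Real.Gamma ((ν : ℝ) / 2))

lemma multivariateTConst_pos {ν : ℕ} (hν : 0 < ν) (d : ℕ) : 0 < multivariateTConst ν d := by
  have hν' : (0 : ℝ) < ν := by exact_mod_cast hν
  have := Real.pi_pos
  exact div_pos (Real.Gamma_pos_of_pos (by positivity))
    (mul_pos (by positivity) (Real.Gamma_pos_of_pos (by positivity)))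

lemma multivariateTDensity_eq {ι : Type*} [Fintype ι] [DecidableEq ι] (ν : ℕ) (c : ι → ℝ)
    {A : Matrix ι ι ℝ} (hA : A.PosSemidef) (x : ι → ℝ) :
    multivariateTDensity ν c A x = A.det ^ (1 / 2 : ℝ) * multivariateTConst ν (Fintype.card ι) *
      ((1 + 1 / (ν : ℝ) * ((x - c) ⬝ᵥ (A *ᵥ (x - c)))) ^
        (((ν : ℝ) + Fintype.card ι) / 2))⁻¹ := by
  have h := hA.dotProduct_mulVec_nonneg (x - c)
  rw [star_trivial] at h
  rw [multivariateTDensity, neg_div, Real.rpow_neg (by positivity), mul_div_assoc]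
  rfl

/-! ### The posterior density is dominated by the proposal density -/

namespace PoissonMRF

variable {N : ℕ} (m : PoissonMRF N) (s : ProposalParams)

lemma exists_likelihood_mul_rpow_le {k : ℝ} (hk : 0 < k) :
    ∃ K, 0 < K ∧ ∀ u : Effects N,
      Real.exp (∑ i, ((u (Sum.inl i) + u (Sum.inr i)) * m.Y i -
        m.E i * Real.exp (u (Sum.inl i) + u (Sum.inr i)))) * (1 + m.likelihoodForm u) ^ k ≤ K := by
  choose K hK h using fun i => exists_exp_sub_exp_mul_rpow_le (m.Y_pos i) (m.E_pos i) hk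
    (m.Y_pos i).le 0
  refine ⟨∏ i, K i, Finset.prod_pos fun i _ => hK i, fun u => ?_⟩
  have hS := m.likelihoodForm_nonneg u
  have hY : ∀ i, 0 ≤ m.Y i * (u (Sum.inl i) + u (Sum.inr i)) ^ 2 := fun i =>
    mul_nonneg (m.Y_pos i).le (sq_nonneg _)
  calc _ ≤ (∏ i, Real.exp ((u (Sum.inl i) + u (Sum.inr i)) * m.Y i -
        m.E i * Real.exp (u (Sum.inl i) + u (Sum.inr i)))) *
        ∏ i, (1 + m.Y i * (u (Sum.inl i) + u (Sum.inr i)) ^ 2) ^ k := by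
        rw [Real.exp_sum, Real.finsetProd_rpow _ _ fun i _ => by linarith [hY i]]
        gcongr
        exact one_add_sum_le_prod_one_add _ hY
    _ ≤ ∏ i, K i := by
        rw [← Finset.prod_mul_distrib]
        refine Finset.prod_le_prod (fun i _ => ?_) fun i _ => ?_
        · have := hY i
          positivity
        · simpa [mul_comm] using h i (u (Sum.inl i) + u (Sum.inr i))

lemma proposalDensity_pos (z : State N) : 0 < m.proposalDensity s z := by
  have hh : 0 < z.τh := z.2.1
  have hc : 0 < z.τc := z.2.2
  have hC := m.posDef_C (δ := 0) le_rfl hh hc.le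
  have hq := hC.posSemidef.dotProduct_mulVec_nonneg (z.Θ - m.centre s.δ z.τh z.τc)
  rw [star_trivial] at hq
  have hdet := hC.det_pos
  have hconst := multivariateTConst_pos s.νr_pos (Fintype.card (Fin N ⊕ Fin N))
  rw [proposalDensity, multivariateTDensity_eq _ _ hC.posSemidef, logTDensity_eq, logTDensity_eq]
  positivity

lemma posteriorDensity_pos (z : State N) : 0 < m.posteriorDensity z := by
  have hh : 0 < z.τh := z.2.1
  have hc : 0 < z.τc := z.2.2
  rw [posteriorDensity]
  positivity

/-- The quadratic form of the proposal grows at most like the product of its likelihood part and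
its prior part, uniformly in `τ_h` and `τ_c`. -/
lemma exists_one_add_form_le :
    ∃ K, 0 < K ∧ ∀ z : State N,
      1 + 1 / (s.νr : ℝ) * ((z.Θ - m.centre s.δ z.τh z.τc) ⬝ᵥ
        (m.C 0 z.τh z.τc *ᵥ (z.Θ - m.centre s.δ z.τh z.τc))) ≤
      K * ((1 + m.likelihoodForm z.Θ) * (1 + m.priorForm z.τh z.τc z.Θ)) := by
  set B := ∑ i, m.Y i * m.μhat i ^ 2
  have hB : 0 ≤ B := Finset.sum_nonneg fun i _ => mul_nonneg (m.Y_pos i).le (sq_nonneg _)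
  refine ⟨3 + 2 * B, by positivity, fun z => ?_⟩
  have hh : 0 < z.τh := z.2.1
  have hc : 0 < z.τc := z.2.2
  have hC := (m.posDef_C (δ := 0) le_rfl hh hc.le).posSemidef
  have hS := m.likelihoodForm_nonneg z.Θ
  have hW := m.priorForm_nonneg hh.le hc.le z.Θ
  have h1 := hC.dotProduct_mulVec_sub_le z.Θ (m.centre s.δ z.τh z.τc)
  have h2 := m.centre_form_le s.δ_nonneg hh hc.le
  have h3 := m.dotProduct_C_mulVec 0 z.τh z.τc z.Θ
  rw [mul_zero, zero_mul, add_zero] at h3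
  have hq := hC.dotProduct_mulVec_nonneg (z.Θ - m.centre s.δ z.τh z.τc)
  rw [star_trivial] at hq
  have hν : 1 / (s.νr : ℝ) ≤ 1 := by
    have : (1 : ℝ) ≤ s.νr := by exact_mod_cast s.νr_pos
    exact (div_le_one (by positivity)).2 this
  have h4 := mul_le_of_le_one_left hq hν
  have h5 := mul_nonneg hS hW
  nlinarith [mul_nonneg hB hS, mul_nonneg hB hW, mul_nonneg hB h5]

/-- The importance weights are bounded. -/
theorem exists_posteriorDensity_le (hN : 0 < N) :
    ∃ K, 0 < K ∧ ∀ z : State N, m.posteriorDensity z ≤ K * m.proposalDensity s z := by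
  set k : ℝ := ((s.νr : ℝ) + Fintype.card (Fin N ⊕ Fin N)) / 2 with hk_def
  have hν : (0 : ℝ) < s.νr := by exact_mod_cast s.νr_pos
  have hk : 0 < k := by positivity
  have hN1 : (1 : ℝ) ≤ N := by exact_mod_cast hN
  have hαc := m.αc_pos
  obtain ⟨KL, hKL, hL⟩ := m.exists_likelihood_mul_rpow_le hk
  obtain ⟨K1, hK1, hU⟩ := m.exists_one_add_form_le s
  obtain ⟨Kh, hKh, hTh⟩ := exists_rpow_mul_exp_le_logTDensity (σ := s.σh) m.αh_pos m.βh_pos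
    s.νh s.μh
  obtain ⟨Kc, hKc, hTc⟩ := exists_rpow_mul_exp_le_logTDensity (σ := s.σc)
    (a := ((N : ℝ) - 1) / 2 + m.αc) (by linarith) m.βc_pos s.νc s.μc
  set G := multivariateTConst s.νr (Fintype.card (Fin N ⊕ Fin N)) with hG_def
  have hG : 0 < G := multivariateTConst_pos s.νr_pos _
  set B := ∏ i, m.Y i
  have hB : 0 < B := Finset.prod_pos fun i _ => m.Y_pos i
  set KW : ℝ := (1 + k / (1 / 2)) ^ k
  have hKW : 0 < KW := by positivity
  refine ⟨KL * KW * K1 ^ k * (B ^ (1 / 2 : ℝ))⁻¹ * Kh * Kc * G⁻¹, by positivity, fun z => ?_⟩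
  have hh : 0 < z.τh := z.2.1
  have hc : 0 < z.τc := z.2.2
  have hC := m.posDef_C (δ := 0) le_rfl hh hc.le
  have hS := m.likelihoodForm_nonneg z.Θ
  have hW := m.priorForm_nonneg hh.le hc.le z.Θ
  have hq := hC.posSemidef.dotProduct_mulVec_nonneg (z.Θ - m.centre s.δ z.τh z.τc)
  rw [star_trivial] at hq
  have hUz := hU z
  have hLz := hL z.Θ
  have hWz := one_add_rpow_le_mul_exp (a := 1 / 2) one_half_pos hk hW
  rw [proposalDensity, multivariateTDensity_eq _ _ hC.posSemidef, ← hk_def, ← hG_def]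
  set U := 1 + 1 / (s.νr : ℝ) * ((z.Θ - m.centre s.δ z.τh z.τc) ⬝ᵥ
        (m.C 0 z.τh z.τc *ᵥ (z.Θ - m.centre s.δ z.τh z.τc)))
  have hU0 : 0 < U := by positivity
  set S := m.likelihoodForm z.Θ
  set W := m.priorForm z.τh z.τc z.Θ with hW_def
  set Λ := Real.exp (∑ i, ((z.Θ (Sum.inl i) + z.Θ (Sum.inr i)) * m.Y i -
        m.E i * Real.exp (z.Θ (Sum.inl i) + z.Θ (Sum.inr i))))
  have hΛ : 0 < Λ := Real.exp_pos _
  have hΘ : Λ * Real.exp (-(1 / 2 * W)) ≤ KL * KW * K1 ^ k * (U ^ k)⁻¹ := by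
    rw [← div_eq_mul_inv, le_div_iff₀ (by positivity)]
    calc Λ * Real.exp (-(1 / 2 * W)) * U ^ k
        ≤ Λ * Real.exp (-(1 / 2 * W)) * (K1 * ((1 + S) * (1 + W))) ^ k := by gcongr
      _ = (Λ * (1 + S) ^ k) * (Real.exp (-(1 / 2 * W)) * (1 + W) ^ k) * K1 ^ k := by
          rw [Real.mul_rpow hK1.le (by positivity), Real.mul_rpow (by positivity) (by positivity)]
          ring
      _ ≤ KL * (Real.exp (-(1 / 2 * W)) * (KW * Real.exp (1 / 2 * W))) * K1 ^ k := by gcongr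
      _ = KL * KW * K1 ^ k := by
          rw [mul_left_comm _ KW, ← Real.exp_add, neg_add_cancel, Real.exp_zero, mul_one]
  have hdet : z.τh ^ ((N : ℝ) / 2) ≤
      (B ^ (1 / 2 : ℝ))⁻¹ * (m.C 0 z.τh z.τc).det ^ (1 / 2 : ℝ) := by
    rw [le_inv_mul_iff₀ (by positivity)]
    calc B ^ (1 / 2 : ℝ) * z.τh ^ ((N : ℝ) / 2) = (B * z.τh ^ N) ^ (1 / 2 : ℝ) := by
          rw [Real.mul_rpow hB.le (by positivity), ← Real.rpow_natCast, ← Real.rpow_mul hh.le,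
            mul_one_div]
      _ ≤ _ := Real.rpow_le_rpow (by positivity) (m.le_det_C hh hc.le) (by norm_num)
  have hThz := hTh z.τh hh
  have hTcz := hTc z.τc hc
  have hprior : Real.exp (-(1 / 2) * (z.τh * (z.θ ⬝ᵥ z.θ))) *
      Real.exp (-(1 / 2) * (z.τc * (z.φ ⬝ᵥ (m.Q *ᵥ z.φ)))) = Real.exp (-(1 / 2 * W)) := by
    rw [← Real.exp_add]
    congr 1
    change _ = -(1 / 2 * (z.τh * (z.θ ⬝ᵥ z.θ) + z.τc * (z.φ ⬝ᵥ (m.Q *ᵥ z.φ))))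
    ring
  calc m.posteriorDensity z = (Λ * (Real.exp (-(1 / 2) * (z.τh * (z.θ ⬝ᵥ z.θ))) *
          Real.exp (-(1 / 2) * (z.τc * (z.φ ⬝ᵥ (m.Q *ᵥ z.φ)))))) * z.τh ^ ((N : ℝ) / 2) *
        (z.τh ^ (m.αh - 1) * Real.exp (-z.τh / m.βh)) *
        (z.τc ^ (((N : ℝ) - 1) / 2 + m.αc - 1) * Real.exp (-z.τc / m.βc)) := by
        have hexp : -z.τh / m.βh - z.τc / m.βc = -z.τh / m.βh + -z.τc / m.βc := by ring
        rw [posteriorDensity, add_sub_assoc ((N : ℝ) / 2), Real.rpow_add hh, hexp, Real.exp_add]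
        change Λ * _ * _ * _ * _ = _
        generalize Real.exp (-z.τh / m.βh) = eh, Real.exp (-z.τc / m.βc) = ec
        ring
    _ ≤ (KL * KW * K1 ^ k * (U ^ k)⁻¹) *
        ((B ^ (1 / 2 : ℝ))⁻¹ * (m.C 0 z.τh z.τc).det ^ (1 / 2 : ℝ)) *
        (Kh * logTDensity s.νh s.μh s.σh z.τh) * (Kc * logTDensity s.νc s.μc s.σc z.τc) := by
        rw [hprior]
        have hdet0 := hC.det_pos
        have h1 := hThz.trans' (by positivity : (0 : ℝ) ≤ _)
        gcongr
    _ = _ := by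
        field_simp

end PoissonMRF

/-! ### Integrability of the proposal density -/

lemma norm_sq_le_dotProduct_self {ι : Type*} [Fintype ι] (u : ι → ℝ) : ‖u‖ ^ 2 ≤ u ⬝ᵥ u := by
  have h0 : 0 ≤ u ⬝ᵥ u := dotProduct_self_star_nonneg u
  rw [← Real.le_sqrt (norm_nonneg u) h0, pi_norm_le_iff_of_nonneg (Real.sqrt_nonneg _)]
  intro i
  refine Real.le_sqrt_of_sq_le ?_
  rw [Real.norm_eq_abs, sq_abs, sq]
  exact Finset.single_le_sum (f := fun j => u j * u j) (fun j _ => mul_self_nonneg _)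
    (Finset.mem_univ i)

/-- Functions that grow at least like `‖x‖ ^ 2` have integrable negative powers, beyond half the
dimension. -/
lemma lintegral_one_add_rpow_lt_top {E : Type*} [NormedAddCommGroup E] [NormedSpace ℝ E]
    [FiniteDimensional ℝ E] [MeasurableSpace E] [BorelSpace E] (μ : Measure E)
    [μ.IsAddHaarMeasure] {c r : ℝ} (hc : 0 < c) (hr : (Module.finrank ℝ E : ℝ) < r)
    {f : E → ℝ} (hf : ∀ x, c * (1 + ‖x‖ ^ 2) ≤ f x) :
    ∫⁻ x, ENNReal.ofReal ((f x ^ (r / 2))⁻¹) ∂μ < ∞ := by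
  have hr0 : 0 < r := (Nat.cast_nonneg _).trans_lt hr
  have h := ((integrable_rpow_neg_one_add_norm_sq (μ := μ) hr).const_mul
    ((c ^ (r / 2))⁻¹)).lintegral_lt_top
  refine (lintegral_mono fun x => ENNReal.ofReal_le_ofReal ?_).trans_lt h
  have h1 : 0 < c * (1 + ‖x‖ ^ 2) := by positivity
  rw [neg_div, Real.rpow_neg (by positivity), ← mul_inv, ← Real.mul_rpow hc.le (by positivity)]
  have := hf x
  gcongr

/-- The mass of the multivariate t density does not depend on its centre and scale matrix. -/
lemma lintegral_multivariateTDensity {ι : Type*} [Fintype ι] [DecidableEq ι] {ν : ℕ}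
    (hν : 0 < ν) (c : ι → ℝ) {A : Matrix ι ι ℝ} (hA : A.PosDef) :
    ∫⁻ x, ENNReal.ofReal (multivariateTDensity ν c A x) =
      ENNReal.ofReal (multivariateTConst ν (Fintype.card ι)) * ∫⁻ u : ι → ℝ, ENNReal.ofReal
        (((1 + 1 / (ν : ℝ) * (u ⬝ᵥ u)) ^ (((ν : ℝ) + Fintype.card ι) / 2))⁻¹) := by
  set g : (ι → ℝ) → ℝ≥0∞ := fun u => ENNReal.ofReal
    (((1 + 1 / (ν : ℝ) * (u ⬝ᵥ u)) ^ (((ν : ℝ) + Fintype.card ι) / 2))⁻¹)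
  have hg : Measurable g := by
    simp only [g, dotProduct]
    fun_prop
  obtain ⟨B, hB⟩ := hA.posSemidef.exists_transpose_mul_self
  have hdet : A.det = B.det ^ 2 := by rw [hB, Matrix.det_mul, Matrix.det_transpose, sq]
  have hB0 : B.det ≠ 0 := by
    intro h
    exact hA.det_pos.ne' (by rw [hdet, h, sq, mul_zero])
  have hsqrt : A.det ^ (1 / 2 : ℝ) = |B.det| := by
    rw [hdet, ← Real.sqrt_eq_rpow, Real.sqrt_sq_eq_abs]
  have hquad : ∀ v : ι → ℝ, v ⬝ᵥ (A *ᵥ v) = (B *ᵥ v) ⬝ᵥ (B *ᵥ v) := by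
    intro v
    rw [hB, ← Matrix.mulVec_mulVec, Matrix.dotProduct_mulVec, Matrix.vecMul_transpose]
  have hG : 0 ≤ multivariateTConst ν (Fintype.card ι) :=
    (multivariateTConst_pos hν _).le
  have hmap := Real.map_matrix_volume_pi_eq_smul_volume_pi hB0
  have hBm : Measurable (Matrix.toLin' B) :=
    (LinearMap.continuous_of_finiteDimensional _).measurable
  calc ∫⁻ x, ENNReal.ofReal (multivariateTDensity ν c A x)
      = ∫⁻ x, ENNReal.ofReal (|B.det| * multivariateTConst ν (Fintype.card ι)) *
          g (Matrix.toLin' B (x - c)) := by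
        refine lintegral_congr fun x => ?_
        rw [multivariateTDensity_eq ν c hA.posSemidef, hsqrt, hquad,
          ENNReal.ofReal_mul (by positivity)]
        rfl
    _ = ENNReal.ofReal (|B.det| * multivariateTConst ν (Fintype.card ι)) *
          ∫⁻ u, g u ∂(Measure.map (Matrix.toLin' B) volume) := by
        rw [lintegral_const_mul' _ _ ENNReal.ofReal_ne_top, lintegral_map hg hBm,
          lintegral_sub_right_eq_self (fun x => g (Matrix.toLin' B x))]
    _ = _ := by
        rw [hmap, lintegral_smul_measure, smul_eq_mul, ← mul_assoc,
          ← ENNReal.ofReal_mul (by positivity), abs_inv, mul_right_comm,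
          mul_inv_cancel₀ (abs_ne_zero.2 hB0), one_mul]

lemma lintegral_multivariateT_lt_top {ι : Type*} [Fintype ι] {ν : ℕ} (hν : 0 < ν) :
    ∫⁻ u : ι → ℝ, ENNReal.ofReal
      (((1 + 1 / (ν : ℝ) * (u ⬝ᵥ u)) ^ (((ν : ℝ) + Fintype.card ι) / 2))⁻¹) < ∞ := by
  have hν1 : (1 : ℝ) ≤ ν := by exact_mod_cast hν
  refine lintegral_one_add_rpow_lt_top volume (c := 1 / (ν : ℝ)) (by positivity) ?_ fun u => ?_
  · rw [Module.finrank_fintype_fun_eq_card]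
    linarith
  · have h1 : 1 / (ν : ℝ) ≤ 1 := (div_le_one (by positivity)).2 hν1
    have h2 := mul_le_mul_of_nonneg_left (norm_sq_le_dotProduct_self u)
      (show 0 ≤ 1 / (ν : ℝ) by positivity)
    linarith

/-- In the variable `log τ`, the log-t density is a Student density. -/
lemma lintegral_logTDensity_lt_top {ν : ℕ} (hν : 0 < ν) (μ : ℝ) {σ : ℝ} (hσ : 0 < σ) :
    ∫⁻ τ in Set.Ioi 0, ENNReal.ofReal (logTDensity ν μ σ τ) < ∞ := by
  have hν' : (0 : ℝ) < ν := by exact_mod_cast hν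
  set c := 1 / ((ν : ℝ) * σ ^ 2)
  have hc : 0 < c := by positivity
  have hchange := lintegral_image_eq_lintegral_abs_deriv_mul (s := Set.univ) (f := Real.exp)
    (f' := Real.exp) .univ (fun x _ => (Real.hasDerivAt_exp x).hasDerivWithinAt)
    Real.exp_injective.injOn (fun τ => ENNReal.ofReal (logTDensity ν μ σ τ))
  rw [Set.image_univ, Real.range_exp, setLIntegral_univ] at hchange
  rw [hchange]
  have hcongr : ∀ x : ℝ, ENNReal.ofReal |Real.exp x| *
      ENNReal.ofReal (logTDensity ν μ σ (Real.exp x)) =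
        ENNReal.ofReal (((1 + c * (x - μ) ^ 2) ^ (((ν : ℝ) + 1) / 2))⁻¹) := by
    intro x
    rw [← ENNReal.ofReal_mul (abs_nonneg _), abs_of_pos (Real.exp_pos x), logTDensity_eq,
      Real.log_exp, ← mul_assoc, mul_one_div_cancel (Real.exp_pos x).ne', one_mul]
  simp_rw [hcongr]
  rw [lintegral_sub_right_eq_self
    (fun x : ℝ => ENNReal.ofReal (((1 + c * x ^ 2) ^ (((ν : ℝ) + 1) / 2))⁻¹)) μ]
  refine lintegral_one_add_rpow_lt_top volume (c := min 1 c) (by positivity) ?_ fun x => ?_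
  · simpa using hν
  · rw [Real.norm_eq_abs, sq_abs]
    nlinarith [min_le_left 1 c, mul_le_mul_of_nonneg_right (min_le_right 1 c) (sq_nonneg x)]

lemma State.lebesgue_ne_zero (N : ℕ) : State.lebesgue N ≠ 0 := by
  have hopen : IsOpen {z : ℝ × ℝ × Effects N | 0 < z.1 ∧ 0 < z.2.1} :=
    (isOpen_lt continuous_const continuous_fst).inter
      (isOpen_lt continuous_const continuous_snd.fst)
  have hpos := hopen.measure_pos volume ⟨(1, 1, 0), one_pos, one_pos⟩
  intro h
  have h1 : ∫⁻ _, 1 ∂(State.lebesgue N) =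
      ∫⁻ _ in {z : ℝ × ℝ × Effects N | 0 < z.1 ∧ 0 < z.2.1}, 1 :=
    lintegral_subtype_comap (State.measurableSet_range N) fun _ => 1
  rw [h, lintegral_zero_measure, setLIntegral_one] at h1
  exact hpos.ne h1

namespace PoissonMRF

variable {N : ℕ} (m : PoissonMRF N) (s : ProposalParams)

lemma lintegral_proposalDensity_lt_top :
    ∫⁻ z, ENNReal.ofReal (m.proposalDensity s z) ∂(State.lebesgue N) < ∞ := by
  set gh : ℝ → ℝ≥0∞ := (Set.Ioi 0).indicator fun τ => ENNReal.ofReal (logTDensity s.νh s.μh s.σh τ)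
  set gc : ℝ → ℝ≥0∞ := (Set.Ioi 0).indicator fun τ => ENNReal.ofReal (logTDensity s.νc s.μc s.σc τ)
  have hgh : ∫⁻ τ, gh τ < ∞ := by
    rw [lintegral_indicator measurableSet_Ioi]
    exact lintegral_logTDensity_lt_top s.νh_pos s.μh s.σh_pos
  have hgc : ∫⁻ τ, gc τ < ∞ := by
    rw [lintegral_indicator measurableSet_Ioi]
    exact lintegral_logTDensity_lt_top s.νc_pos s.μc s.σc_pos
  set J : ℝ≥0∞ := ENNReal.ofReal (multivariateTConst s.νr (Fintype.card (Fin N ⊕ Fin N))) *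
    ∫⁻ u : Effects N, ENNReal.ofReal (((1 + 1 / (s.νr : ℝ) * (u ⬝ᵥ u)) ^
      (((s.νr : ℝ) + Fintype.card (Fin N ⊕ Fin N)) / 2))⁻¹)
  have hJ : J < ∞ :=
    ENNReal.mul_lt_top ENNReal.ofReal_lt_top (lintegral_multivariateT_lt_top s.νr_pos)
  set F : ℝ × ℝ × Effects N → ℝ≥0∞ := fun z =>
    gh z.1 * (gc z.2.1 * ENNReal.ofReal
      (multivariateTDensity s.νr (m.centre s.δ z.1 z.2.1) (m.C 0 z.1 z.2.1) z.2.2))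
  have hF : ∀ z : State N, ENNReal.ofReal (m.proposalDensity s z) = F z := by
    intro z
    have hh : 0 < z.τh := z.2.1
    have hc : 0 < z.τc := z.2.2
    have h1 : gh z.1.1 = ENNReal.ofReal (logTDensity s.νh s.μh s.σh z.τh) :=
      Set.indicator_of_mem (s := Set.Ioi 0) hh _
    have h2 : gc z.1.2.1 = ENNReal.ofReal (logTDensity s.νc s.μc s.σc z.τc) :=
      Set.indicator_of_mem (s := Set.Ioi 0) hc _
    simp only [F]
    rw [h1, h2, proposalDensity, mul_assoc, ENNReal.ofReal_mul, ENNReal.ofReal_mul]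
    · rfl
    · rw [logTDensity_eq]
      positivity
    · rw [logTDensity_eq]
      positivity
  have hinner : ∀ τh τc : ℝ, ∫⁻ Θ, F (τh, τc, Θ) ≤ gh τh * (gc τc * J) := by
    intro τh τc
    by_cases hh : 0 < τh
    swap
    · simp [F, gh, hh]
    by_cases hc : 0 < τc
    swap
    · simp [F, gc, hc]
    simp only [F]
    have hgh_top : gh τh ≠ ∞ := by simp [gh, hh]
    have hgc_top : gc τc ≠ ∞ := by simp [gc, hc]
    rw [lintegral_const_mul' _ _ hgh_top, lintegral_const_mul' _ _ hgc_top,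
      lintegral_multivariateTDensity s.νr_pos _ (m.posDef_C le_rfl hh hc.le)]
  have hgh_top : ∀ τ, gh τ ≠ ∞ := fun τ => by
    by_cases h : 0 < τ <;> simp [gh, h]
  calc ∫⁻ z, ENNReal.ofReal (m.proposalDensity s z) ∂(State.lebesgue N)
      = ∫⁻ z : State N, F z ∂(State.lebesgue N) := lintegral_congr hF
    _ = ∫⁻ z in {z : ℝ × ℝ × Effects N | 0 < z.1 ∧ 0 < z.2.1}, F z :=
        lintegral_subtype_comap (State.measurableSet_range N) F
    _ ≤ ∫⁻ z, F z := setLIntegral_le_lintegral _ _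
    _ ≤ ∫⁻ τh, ∫⁻ w : ℝ × Effects N, F (τh, w) := lintegral_prod_le _
    _ ≤ ∫⁻ τh, ∫⁻ τc, ∫⁻ Θ, F (τh, τc, Θ) := lintegral_mono fun τh => lintegral_prod_le _
    _ ≤ ∫⁻ τh, ∫⁻ τc, gh τh * (gc τc * J) :=
        lintegral_mono fun τh => lintegral_mono fun τc => hinner τh τc
    _ = (∫⁻ τh, gh τh) * ((∫⁻ τc, gc τc) * J) := by
        simp_rw [lintegral_const_mul' _ _ (hgh_top _), lintegral_mul_const' _ _ hJ.ne]
        exact lintegral_mul_const' _ _ (ENNReal.mul_lt_top hgc hJ).ne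
    _ < ∞ := ENNReal.mul_lt_top hgh (ENNReal.mul_lt_top hgc hJ)

end PoissonMRF

theorem proposition2 {N : ℕ} (hN : 0 < N) (m : PoissonMRF N) (s : ProposalParams) :
    IsProbabilityMeasure m.posterior ∧
      IsProbabilityMeasure (m.proposal s) ∧
      IsMarkovKernel (m.mhChain s) ∧
      (m.mhChain s).Invariant m.posterior ∧
      UniformlyErgodic (m.mhChain s) m.posterior := by
  obtain ⟨K, hK, hle⟩ := m.exists_posteriorDensity_le s hN
  exact independenceMH_of_bounded_weights m.measurable_posteriorDensity
    (m.measurable_proposalDensity s) m.posteriorDensity_pos (m.proposalDensity_pos s) hK hle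
    (State.lebesgue_ne_zero N) (m.lintegral_proposalDensity_lt_top s).ne
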